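/- **Setting.** For a metric space $Y$, let $bmY$ and $bcY$ denote the bounded Borel measurable and the bounded continuous functions $Y\to\mathbb R$, with the supremum norm. Let $X$ and $Z$ be metric spaces, let $A$ be a separable metric space, and put $S = X\times Z$. A dynamic program consists of a correspondence $\Gamma$ assigning to each $(x,z)\in S$ a set $\Gamma(x,z)\subset A$ of feasible actions, a Markov transition kernel $Q$ on $Z$, a nonempty set $\mathcal V$ of Borel measurable functions $S\to\mathbb R$, and a map $H$ assigning a real number $H(x,z,a,v)$ to each $(x,z)\in S$, $a\in\Gamma(x,z)$, $v\in\mathcal V$. A feasible policy is a Borel measurable map $\sigma:S\to A$ with $\sigma(x,z)\in\Gamma(x,z)$ for all $(x,z)$; $\Sigma$ is the set of feasible policies. For $v\in\mathcal V$ put $$(T_\sigma v)(x,z)=H(x,z,\sigma(x,z),v),\qquad (Tv)(x,z)=\sup_{a\in\Gamma(x,z)}H(x,z,a,v).$$ The $\sigma$-value function is $v_\sigma(x,z)=\lim_{n\to\infty}(T_\sigma^n v_0)(x,z)$; it is well defined if for all $v_0 \in \mathcal V$ and all $(x,z)\in S$ this limit exists in $\mathbb R$ and does not depend on $v_0$.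 The value function is $v^*(x,z)=\sup_{\sigma\in\Sigma}v_\sigma(x,z)$; it is well defined if every $v_\sigma$ is and these suprema are finite. A policy $\sigma\in\Sigma$ is optimal if $v_\sigma=v^*$. A self-map $M$ of a metric space is eventually contracting if for some $n\ge 1$ the iterate $M^n$ is a contraction (Lipschitz with constant less than $1$). **Hypotheses.** * *Regularity:* $\mathcal V=bmS$; $\Gamma$ is continuous (upper and lower hemicontinuous) with nonempty compact values; and on the set of all $(x,z,a)$ with $a\in\Gamma(x,z)$ the map $(x,z,a)\mapsto H(x,z,a,v)$ is Borel measurable for every $v\in bmS$, continuous for every $v\in bcS$, and bounded for at least one $v\in bcS$. * *Monotonicity:* if $v,w\in\mathcal V$ and $v\le w$, then $H(x,z,a,v)\le H(x,z,a,w)$ for all $(x,z)\in S$ and $a\in\Gamma(x,z)$. * *Long-run contractivity:* there is a nonnegative $\beta\in bmZ$ such that $$|H(x,z,a,v)-H(x,z,a,w)|\le\beta(z)\int\sup_{x'\in X}|v(x',z')-w(x',z')|\,Q(z,dz')$$ for all $v,w\in\mathcal V$, $(x,z)\in S$ and $a\in\Gamma(x,z)$ (where the integral is the upper integral if the integrand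 is not measurable), and such that the operator $L_\beta$ on $bmZ$ given by $(L_\beta h)(z)=\beta(z)\int h(z')\,Q(z,dz')$ has spectral radius $r(L_\beta)=\lim_{n\to\infty}\|L_\beta^n\|^{1/n}<1$. **Theorem.** Under these three hypotheses, the supremum defining $Tv$ is finite at every state for every $v \in \mathcal V$, and: * (a) For every $\sigma\in\Sigma$, $T_\sigma$ is an eventually contracting self-map of $bmS$, and $T$ is an eventually contracting self-map of $bcS$. * (b) For every $\sigma\in\Sigma$, $v_\sigma$ is a well-defined element of $bmS$. * (c) The value function $v^*$ is well defined, bounded and continuous, and it is the unique fixed point of $T$ in $bcS$. * (d) An optimal policy exists. * (e) A policy $\sigma\in\Sigma$ is optimal if and only if $\sigma(x,z)\in\operatorname{argmax}_{a\in\Gamma(x,z)}H(x,z,a,v^*)$ for every $(x,z)\in S$. -/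

import Mathlib

open MeasureTheory ProbabilityTheory Filter Topology
open scoped ENNReal NNReal BoundedContinuousFunction

noncomputable section

/-- The bounded Borel measurable functions `Y → ℝ`, as a subspace of all bounded functions
with the supremum norm. -/
def bmSubmodule (Y : Type*) [TopologicalSpace Y] : Submodule ℝ (lp (fun _ : Y => ℝ) ∞) where
  carrier := {f | Measurable[borel Y] (f : Y → ℝ)}
  add_mem' := by
    intro f g hf hg
    let : MeasurableSpace Y := borel Y
    exact Measurable.add hf hg
  zero_mem' := by
    let : MeasurableSpace Y := borel Y
    exact measurable_zero
  smul_mem' := by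
    intro c f hf
    let : MeasurableSpace Y := borel Y
    exact Measurable.const_smul hf c

/-- The normed space of bounded Borel measurable functions `Y → ℝ` with the supremum norm. -/
def bm (Y : Type*) [TopologicalSpace Y] : Type _ :=
  bmSubmodule Y

instance bm.instNormedAddCommGroup (Y : Type*) [TopologicalSpace Y] :
    NormedAddCommGroup (bm Y) :=
  inferInstanceAs (NormedAddCommGroup (bmSubmodule Y))

instance bm.instNormedSpace (Y : Type*) [TopologicalSpace Y] : NormedSpace ℝ (bm Y) :=
  inferInstanceAs (NormedSpace ℝ (bmSubmodule Y))

instance bm.instCoeFun (Y : Type*) [TopologicalSpace Y] : CoeFun (bm Y) (fun _ => Y → ℝ) :=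
  ⟨fun f => (f.1 : Y → ℝ)⟩

/-- A bounded measurable function, as an element of `bm Y`. -/
def bm.mk {Y : Type*} [TopologicalSpace Y] (f : Y → ℝ) (hf : Measurable[borel Y] f)
    (hb : ∃ C, ∀ y, |f y| ≤ C) : bm Y :=
  ⟨⟨f, memℓp_infty (by
    obtain ⟨C, hC⟩ := hb
    refine ⟨C, ?_⟩
    rintro _ ⟨y, rfl⟩
    exact hC y)⟩, hf⟩

theorem bm.measurable {Y : Type*} [TopologicalSpace Y] (f : bm Y) : Measurable[borel Y] (f : Y → ℝ) :=
  f.2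

theorem bm.abs_le_norm {Y : Type*} [TopologicalSpace Y] (f : bm Y) (y : Y) : |f y| ≤ ‖f‖ :=
  lp.norm_apply_le_norm (by simp) f.1 y

theorem bm.norm_le {Y : Type*} [TopologicalSpace Y] (f : bm Y) {C : ℝ} (hC : 0 ≤ C)
    (h : ∀ y, |f y| ≤ C) : ‖f‖ ≤ C :=
  lp.norm_le_of_forall_le hC h

theorem bm.integrable {Y : Type*} [TopologicalSpace Y] (f : bm Y) (μ : @Measure Y (borel Y))
    [IsProbabilityMeasure μ] : Integrable (f : Y → ℝ) μ :=
  Integrable.of_bound (Measurable.aestronglyMeasurable (bm.measurable f)) ‖f‖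
    (Eventually.of_forall fun y => bm.abs_le_norm f y)

/-- The function `z ↦ β z * ∫ h dQ(z, ·)`. -/
def discountFun {Z : Type*} [TopologicalSpace Z] (Q : @Kernel Z Z (borel Z) (borel Z))
    (β h : bm Z) (z : Z) : ℝ :=
  β z * ∫ z', h z' ∂(Q z)

theorem abs_discountFun_le {Z : Type*} [TopologicalSpace Z]
    (Q : @Kernel Z Z (borel Z) (borel Z)) [IsMarkovKernel Q] (β h : bm Z) (z : Z) :
    |discountFun Q β h z| ≤ ‖β‖ * ‖h‖ := by
  unfold discountFun
  rw [abs_mul]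
  refine mul_le_mul (bm.abs_le_norm β z) ?_ (abs_nonneg _) (norm_nonneg _)
  have := norm_integral_le_of_norm_le_const (μ := Q z) (f := (h : Z → ℝ)) (C := ‖h‖)
    (Eventually.of_forall fun y => bm.abs_le_norm h y)
  simpa using this

theorem measurable_discountFun {Z : Type*} [TopologicalSpace Z]
    (Q : @Kernel Z Z (borel Z) (borel Z)) [IsMarkovKernel Q] (β h : bm Z) :
    Measurable[borel Z] (discountFun Q β h) := by
  let : MeasurableSpace Z := borel Z
  exact Measurable.mul (bm.measurable β)
    (StronglyMeasurable.integral_kernel (κ := Q) (bm.measurable h).stronglyMeasurable).measurable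

/-- The bounded linear operator `L_β` on `bm Z`, `(L_β h) z = β z * ∫ h z' Q(z, dz')`. -/
def discountOp {Z : Type*} [TopologicalSpace Z] (Q : @Kernel Z Z (borel Z) (borel Z))
    [IsMarkovKernel Q] (β : bm Z) : bm Z →L[ℝ] bm Z :=
  LinearMap.mkContinuous
    { toFun := fun h => bm.mk (discountFun Q β h) (measurable_discountFun Q β h)
        ⟨‖β‖ * ‖h‖, abs_discountFun_le Q β h⟩
      map_add' := by
        intro f g
        refine Subtype.ext (lp.ext (funext fun z => ?_))
        change β z * ∫ z', (f z' + g z') ∂(Q z) =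
          β z * ∫ z', f z' ∂(Q z) + β z * ∫ z', g z' ∂(Q z)
        rw [integral_add (bm.integrable f _) (bm.integrable g _), mul_add]
      map_smul' := by
        intro c f
        refine Subtype.ext (lp.ext (funext fun z => ?_))
        change β z * ∫ z', (c * f z') ∂(Q z) = c * (β z * ∫ z', f z' ∂(Q z))
        rw [integral_const_mul]
        ring }
    ‖β‖
    (fun h => bm.norm_le _ (by positivity) (abs_discountFun_le Q β h))

theorem discountOp_apply {Z : Type*} [TopologicalSpace Z]
    (Q : @Kernel Z Z (borel Z) (borel Z)) [IsMarkovKernel Q] (β h : bm Z) (z : Z) :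
    discountOp Q β h z = β z * ∫ z', h z' ∂(Q z) :=
  rfl

/-- `r` is the spectral radius of `L`, in the sense of Gelfand's formula
`r = lim ‖L ^ n‖ ^ (1 / n)`. -/
def IsSpectralRadius {E : Type*} [NormedAddCommGroup E] [NormedSpace ℝ E] (L : E →L[ℝ] E)
    (r : ℝ) : Prop :=
  Tendsto (fun n : ℕ => ‖L ^ n‖ ^ (1 / (n : ℝ))) atTop (𝓝 r)

/-- The upper integral of a `[0, ∞]`-valued function: the infimum of the integrals of its
measurable majorants. -/
def upperIntegral {Y : Type*} {_ : MeasurableSpace Y} (μ : Measure Y) (f : Y → ℝ≥0∞) : ℝ≥0∞ :=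
  ⨅ (g : Y → ℝ≥0∞) (_ : Measurable g) (_ : f ≤ g), ∫⁻ y, g y ∂μ

/-- For measurable functions the upper integral is the ordinary integral. -/
theorem upperIntegral_eq_lintegral {Y : Type*} {_ : MeasurableSpace Y} (μ : Measure Y)
    {f : Y → ℝ≥0∞} (hf : Measurable f) : upperIntegral μ f = ∫⁻ y, f y ∂μ :=
  le_antisymm (iInf_le_of_le f (iInf_le_of_le hf (iInf_le _ le_rfl)))
    (le_iInf fun _ => le_iInf fun _ => le_iInf fun h => lintegral_mono h)

/-- A self-map of a metric space is eventually contracting if one of its iterates is a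
contraction. -/
def EventuallyContracting {Y : Type*} [MetricSpace Y] (M : Y → Y) : Prop :=
  ∃ n : ℕ, 1 ≤ n ∧ ∃ c : ℝ≥0, ContractingWith c M^[n]

/-- A dynamic program with endogenous states in `X`, exogenous states in `Z` and actions in
`A`. The aggregator `H` is relevant only at feasible actions and at candidate value
functions; its values elsewhere are never used. -/
structure DynamicProgram (X Z A : Type*) [MetricSpace X] [MetricSpace Z] [MetricSpace A] where
  /-- the feasible correspondence -/
  Γ : X × Z → Set A
  /-- the transition kernel of the exogenous state -/
  Q : @Kernel Z Z (borel Z) (borel Z)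
  /-- `Q z` is a probability measure for each `z` -/
  markov : IsMarkovKernel Q
  /-- the candidate value functions -/
  V : Set (X × Z → ℝ)
  V_nonempty : V.Nonempty
  V_measurable : ∀ v ∈ V, Measurable[borel (X × Z)] v
  /-- the continuation aggregator -/
  H : X → Z → A → (X × Z → ℝ) → ℝ

namespace DynamicProgram

variable {X Z A : Type*} [MetricSpace X] [MetricSpace Z] [MetricSpace A]

/-- The feasible state-action pairs. -/
def graph (D : DynamicProgram X Z A) : Set ((X × Z) × A) :=
  {p | p.2 ∈ D.Γ p.1}

/-- The aggregator at a given continuation value, on the feasible state-action pairs. -/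
def HGraph (D : DynamicProgram X Z A) (v : X × Z → ℝ) (p : D.graph) : ℝ :=
  D.H p.1.1.1 p.1.1.2 p.1.2 v

/-- `σ` is a feasible policy: a Borel measurable selection of the feasible correspondence. -/
def IsPolicy (D : DynamicProgram X Z A) (σ : X × Z → A) : Prop :=
  @Measurable _ _ (borel (X × Z)) (borel A) σ ∧ ∀ s, σ s ∈ D.Γ s

/-- The operator `T_σ`. -/
def policyOp (D : DynamicProgram X Z A) (σ : X × Z → A) (v : X × Z → ℝ) : X × Z → ℝ :=
  fun s => D.H s.1 s.2 (σ s) v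

/-- The set of values `H(x, z, a, v)` over feasible actions `a` at the state `s = (x, z)`. -/
def actionValues (D : DynamicProgram X Z A) (v : X × Z → ℝ) (s : X × Z) : Set ℝ :=
  (fun a => D.H s.1 s.2 a v) '' D.Γ s

/-- The Bellman operator `T`. -/
def bellmanOp (D : DynamicProgram X Z A) (v : X × Z → ℝ) : X × Z → ℝ :=
  fun s => sSup (D.actionValues v s)

/-- `w` is the `σ`-value function: for every terminal value `v₀ ∈ V`, the iterates
`T_σ^n v₀` converge to `w` pointwise. -/
def IsPolicyValue (D : DynamicProgram X Z A) (σ : X × Z → A) (w : X × Z → ℝ) : Prop :=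
  ∀ v₀ ∈ D.V, ∀ s, Tendsto (fun n : ℕ => (D.policyOp σ)^[n] v₀ s) atTop (𝓝 (w s))

/-- `w` is the value function: every feasible policy has a well-defined value, and `w s` is
the (finite) supremum of these values at `s`, for every state `s`. -/
def IsValueFunction (D : DynamicProgram X Z A) (w : X × Z → ℝ) : Prop :=
  (∀ σ, D.IsPolicy σ → ∃ u, D.IsPolicyValue σ u) ∧
    ∀ s, IsLUB {r : ℝ | ∃ σ u, D.IsPolicy σ ∧ D.IsPolicyValue σ u ∧ u s = r} (w s)

/-- `σ` is an optimal policy: it is feasible and its value is the value function. -/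
def IsOptimal (D : DynamicProgram X Z A) (σ : X × Z → A) : Prop :=
  D.IsPolicy σ ∧ ∃ w, D.IsValueFunction w ∧ D.IsPolicyValue σ w

/-- Regularity of a dynamic program. -/
structure IsRegular (D : DynamicProgram X Z A) : Prop where
  V_eq : D.V = {v | ∃ u : bm (X × Z), ⇑u = v}
  upper : UpperHemicontinuous D.Γ
  lower : LowerHemicontinuous D.Γ
  nonempty : ∀ s, (D.Γ s).Nonempty
  compact : ∀ s, IsCompact (D.Γ s)
  H_measurable : ∀ v : bm (X × Z), Measurable[borel D.graph] (D.HGraph v)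
  H_continuous : ∀ v : (X × Z) →ᵇ ℝ, Continuous (D.HGraph v)
  H_bounded : ∃ v : (X × Z) →ᵇ ℝ, ∃ C : ℝ, ∀ p, |D.HGraph v p| ≤ C

/-- Monotonicity of the aggregator in the continuation value. -/
def IsMonotone (D : DynamicProgram X Z A) : Prop :=
  ∀ v ∈ D.V, ∀ w ∈ D.V, v ≤ w → ∀ x z, ∀ a ∈ D.Γ (x, z), D.H x z a v ≤ D.H x z a w

/-- Long-run contractivity. The inner supremum need not be a measurable function of the
exogenous state, hence the upper integral. -/
def IsLongRunContractive (D : DynamicProgram X Z A) : Prop :=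
  haveI := D.markov
  ∃ β : bm Z, (∀ z, 0 ≤ β z) ∧
    (∀ v ∈ D.V, ∀ w ∈ D.V, ∀ x z, ∀ a ∈ D.Γ (x, z),
      ENNReal.ofReal |D.H x z a v - D.H x z a w| ≤
        ENNReal.ofReal (β z) *
          upperIntegral (D.Q z) (fun z' => ⨆ x' : X, ENNReal.ofReal |v (x', z') - w (x', z')|)) ∧
    ∃ r : ℝ, r < 1 ∧ IsSpectralRadius (discountOp D.Q β) r

end DynamicProgram

end

/-! The supremum over `x'` in the contractivity bound moves the problem to the exogenous state: if
`|v - w| ≤ h(z)` with `h` in `bm Z`, then `T_σ` and `T` turn the bound into `L_β h`, because `h` is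
itself a measurable majorant for the upper integral. Iterating from a constant `h` gives distances
at most `‖L_β ^ n‖` times the initial one. Gelfand's formula with radius below 1 sends these norms
to 0, so both operators are eventually contracting. `Dominated` packages this argument for both.

Completeness of `bm S` and `bc S` then yields fixed points. That of `T_σ` is the value of `σ`, since
all iterates are attracted to it. Berge's maximum theorem makes `T` preserve `bc S`, giving a fixed
point `vstar`.

For each `σ`, `T_σ vstar ≤ T vstar = vstar`, and monotonicity iterates this to `v_σ ≤ vstar`. A
measurable selection `τ` of maximizers satisfies `T_τ vstar = vstar`, so its value is `vstar`: the
supremum is attained. Optimality of `σ` thus means `T_σ vstar = vstar`, that is, `σ` maximizes at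
every state. -/

section Correspondence

/-! ### Hemicontinuous correspondences and Berge's theorem. -/

variable {S A : Type*} [TopologicalSpace S] [TopologicalSpace A] {Γ : S → Set A}

/-- The projection of a closed set along an upper hemicontinuous compact-valued correspondence
is closed. -/
theorem UpperHemicontinuous.isClosed_setOf_exists_mem (hΓ : UpperHemicontinuous Γ)
    (hc : ∀ s, IsCompact (Γ s)) {C : Set (S × A)} (hC : IsClosed C) :
    IsClosed {s | ∃ a ∈ Γ s, (s, a) ∈ C} := by
  rw [← isOpen_compl_iff, isOpen_iff_mem_nhds]
  intro s hs
  have hsub : ({s} : Set S) ×ˢ Γ s ⊆ Cᶜ := by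
    rintro ⟨t, a⟩ ⟨rfl, ha⟩ hmem
    exact hs ⟨a, ha, hmem⟩
  obtain ⟨U, W, hU, hW, hsU, hΓW, hUW⟩ :=
    generalized_tube_lemma isCompact_singleton (hc s) hC.isOpen_compl hsub
  filter_upwards [hΓ.forall_isOpen s W hW hΓW, hU.mem_nhds (hsU rfl)] with t ht htU
  rintro ⟨a, ha, hmem⟩
  exact hUW ⟨htU, ht ha⟩ hmem

/-- The projection of an open set along a lower hemicontinuous correspondence is open. -/
theorem LowerHemicontinuous.isOpen_setOf_exists_mem (hΓ : LowerHemicontinuous Γ)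
    {O : Set (S × A)} (hO : IsOpen O) : IsOpen {s | ∃ a ∈ Γ s, (s, a) ∈ O} := by
  rw [isOpen_iff_mem_nhds]
  rintro s ⟨a, ha, hmem⟩
  obtain ⟨U, W, hU, hW, hsU, haW, hUW⟩ := isOpen_prod_iff.1 hO s a hmem
  filter_upwards [(lowerHemicontinuous_iff_isOpen_inter_nonempty.1 hΓ W hW).mem_nhds
    ⟨a, ha, haW⟩, hU.mem_nhds hsU] with t ht htU
  obtain ⟨b, hb, hbW⟩ := ht
  exact ⟨b, hb, hUW ⟨htU, hbW⟩⟩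

/-- Continuity on the graph makes the preimage of `t` the trace of a closed subset of `S × A`, which
can be projected. The extra set `F` serves the measurability of the argmax correspondence. -/
theorem UpperHemicontinuous.isClosed_setOf_exists_mem_preimage (hΓ : UpperHemicontinuous Γ)
    (hc : ∀ s, IsCompact (Γ s)) {G : S × A → ℝ} (hG : ContinuousOn G {p | p.2 ∈ Γ p.1})
    {F : Set A} (hF : IsClosed F) {t : Set ℝ} (ht : IsClosed t) :
    IsClosed {s | ∃ a ∈ Γ s, a ∈ F ∧ G (s, a) ∈ t} := by
  obtain ⟨u, hu, hut⟩ := continuousOn_iff_isClosed.1 hG t ht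
  convert hΓ.isClosed_setOf_exists_mem hc (hu.inter (hF.preimage continuous_snd)) using 1
  ext s
  refine exists_congr fun a => and_congr_right fun ha => ?_
  have := Set.ext_iff.1 hut (s, a)
  simp only [Set.mem_inter_iff, Set.mem_preimage, Set.mem_ofPred, ha, and_true] at this ⊢
  rw [this, and_comm]

theorem LowerHemicontinuous.isOpen_setOf_exists_mem_preimage (hΓ : LowerHemicontinuous Γ)
    {G : S × A → ℝ} (hG : ContinuousOn G {p | p.2 ∈ Γ p.1}) {t : Set ℝ} (ht : IsOpen t) :
    IsOpen {s | ∃ a ∈ Γ s, G (s, a) ∈ t} := by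
  obtain ⟨u, hu, hut⟩ := continuousOn_iff'.1 hG t ht
  convert hΓ.isOpen_setOf_exists_mem hu using 1
  ext s
  refine exists_congr fun a => and_congr_right fun ha => ?_
  have := Set.ext_iff.1 hut (s, a)
  simpa [ha] using this

theorem exists_isGreatest_image_of_continuousOn_graph (hc : ∀ s, IsCompact (Γ s))
    (hne : ∀ s, (Γ s).Nonempty) {G : S × A → ℝ} (hG : ContinuousOn G {p | p.2 ∈ Γ p.1}) (s : S) :
    ∃ a ∈ Γ s, IsMaxOn (fun a => G (s, a)) (Γ s) a ∧
      IsGreatest ((fun a => G (s, a)) '' Γ s) (G (s, a)) := by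
  have hcont : ContinuousOn (fun a => G (s, a)) (Γ s) :=
    hG.comp (by fun_prop) fun a ha => ha
  obtain ⟨a, ha, hmax⟩ := (hc s).exists_isMaxOn (hne s) hcont
  refine ⟨a, ha, hmax, ⟨a, ha, rfl⟩, ?_⟩
  rintro _ ⟨b, hb, rfl⟩
  exact hmax hb

/-- Berge's maximum theorem: the maximum value of a continuous function along a continuous
compact-valued correspondence depends continuously on the parameter. -/
theorem continuous_sSup_image_of_hemicontinuous (hu : UpperHemicontinuous Γ)
    (hl : LowerHemicontinuous Γ) (hc : ∀ s, IsCompact (Γ s)) (hne : ∀ s, (Γ s).Nonempty)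
    {G : S × A → ℝ} (hG : ContinuousOn G {p | p.2 ∈ Γ p.1}) :
    Continuous fun s => sSup ((fun a => G (s, a)) '' Γ s) := by
  have key := exists_isGreatest_image_of_continuousOn_graph hc hne hG
  rw [continuous_iff_lower_upperSemicontinuous, lowerSemicontinuous_iff_isOpen_preimage,
    upperSemicontinuous_iff_isClosed_preimage]
  refine ⟨fun y => ?_, fun y => ?_⟩
  · convert hl.isOpen_setOf_exists_mem_preimage hG (isOpen_Ioi (a := y)) using 1
    ext s
    obtain ⟨a, ha, -, hgr⟩ := key s
    change y < sSup _ ↔ ∃ a ∈ Γ s, y < G (s, a)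
    rw [hgr.csSup_eq]
    exact ⟨fun h => ⟨a, ha, h⟩, fun ⟨b, hb, h⟩ => h.trans_le (hgr.2 ⟨b, hb, rfl⟩)⟩
  · convert hu.isClosed_setOf_exists_mem_preimage hc hG isClosed_univ (isClosed_Ici (a := y))
      using 1
    ext s
    obtain ⟨a, ha, -, hgr⟩ := key s
    change y ≤ sSup _ ↔ ∃ a ∈ Γ s, a ∈ Set.univ ∧ y ≤ G (s, a)
    rw [hgr.csSup_eq]
    exact ⟨fun h => ⟨a, ha, trivial, h⟩, fun ⟨b, hb, _, h⟩ => h.trans (hgr.2 ⟨b, hb, rfl⟩)⟩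

end Correspondence

/-! ### Measurable selection of maximizers. -/

section MeasurableSelection

variable {S A : Type*} [MeasurableSpace S] [MetricSpace A]

/-- A measurable compact-valued correspondence can be shrunk measurably to values of diameter
at most `2 * ε`. -/
theorem exists_measurable_subcorrespondence [TopologicalSpace.SeparableSpace A] [Nonempty A]
    {ε : ℝ} (hε : 0 < ε) {Ψ : S → Set A} (hc : ∀ s, IsCompact (Ψ s)) (hne : ∀ s, (Ψ s).Nonempty)
    (hm : ∀ F, IsClosed F → MeasurableSet {s | (Ψ s ∩ F).Nonempty}) :
    ∃ (f : S → A) (Ψ' : S → Set A), @Measurable _ _ _ (borel A) f ∧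
      (∀ s, Ψ' s ⊆ Ψ s ∩ Metric.closedBall (f s) ε) ∧ (∀ s, IsCompact (Ψ' s)) ∧
      (∀ s, (Ψ' s).Nonempty) ∧
      ∀ F, IsClosed F → MeasurableSet {s | (Ψ' s ∩ F).Nonempty} := by
  classical
  let a : ℕ → A := TopologicalSpace.denseSeq A
  have hex : ∀ s, ∃ i, (Ψ s ∩ Metric.closedBall (a i) ε).Nonempty := by
    intro s
    obtain ⟨b, hb⟩ := hne s
    obtain ⟨i, hi⟩ := (TopologicalSpace.denseRange_denseSeq A).exists_dist_lt b hε
    exact ⟨i, b, hb, hi.le⟩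
  -- Taking the least index of a dense point whose ball meets `Ψ s` makes the choice of centre
  -- measurable with countably many values.
  let k : S → ℕ := fun s => Nat.find (hex s)
  have hk : Measurable k := measurable_find hex fun i => hm _ Metric.isClosed_closedBall
  refine ⟨fun s => a (k s), fun s => Ψ s ∩ Metric.closedBall (a (k s)) ε,
    (measurable_from_nat (mα := borel A)).comp hk, fun s => subset_rfl,
    fun s => (hc s).inter_right Metric.isClosed_closedBall, fun s => Nat.find_spec (hex s), ?_⟩
  intro F hF
  have : {s | (Ψ s ∩ Metric.closedBall (a (k s)) ε ∩ F).Nonempty} =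
      ⋃ i, k ⁻¹' {i} ∩ {s | (Ψ s ∩ (Metric.closedBall (a i) ε ∩ F)).Nonempty} := by
    ext s
    simp [Set.inter_assoc]
  rw [this]
  exact MeasurableSet.iUnion fun i => (hk (measurableSet_singleton i)).inter
    (hm _ (Metric.isClosed_closedBall.inter hF))

/-- Measurable selection for compact-valued correspondences into a separable metric space. -/
theorem exists_measurable_selection [TopologicalSpace.SeparableSpace A] {Ψ : S → Set A}
    (hc : ∀ s, IsCompact (Ψ s)) (hne : ∀ s, (Ψ s).Nonempty)
    (hm : ∀ F, IsClosed F → MeasurableSet {s | (Ψ s ∩ F).Nonempty}) :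
    ∃ σ : S → A, @Measurable _ _ _ (borel A) σ ∧ ∀ s, σ s ∈ Ψ s := by
  -- The shrinking lemma needs a point of `A`, which is available only when `S` is nonempty.
  rcases isEmpty_or_nonempty S with hS | ⟨⟨s₀⟩⟩
  · exact ⟨fun s => isEmptyElim s, fun _ _ => by simp [Set.eq_empty_of_isEmpty],
      fun s => isEmptyElim s⟩
  have : Nonempty A := ⟨(hne s₀).some⟩
  let C := {Φ : S → Set A // (∀ s, IsCompact (Φ s)) ∧ (∀ s, (Φ s).Nonempty) ∧
    ∀ F, IsClosed F → MeasurableSet {s | (Φ s ∩ F).Nonempty}}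
  have step : ∀ (n : ℕ) (Φ : C), ∃ (f : S → A) (Φ' : C), @Measurable _ _ _ (borel A) f ∧
      ∀ s, Φ'.1 s ⊆ Φ.1 s ∩ Metric.closedBall (f s) ((1 / 2 : ℝ) ^ n) := by
    rintro n ⟨Φ, h1, h2, h3⟩
    obtain ⟨f, Φ', hf, hsub, h1', h2', h3'⟩ :=
      exists_measurable_subcorrespondence (ε := (1 / 2 : ℝ) ^ n) (by positivity) h1 h2 h3
    exact ⟨f, ⟨Φ', h1', h2', h3'⟩, hf, hsub⟩
  choose f next hf hnext using step
  let Φ : ℕ → C := fun n => Nat.rec ⟨Ψ, hc, hne, hm⟩ (fun n Φ => next n Φ) n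
  have hΦ : ∀ n s, (Φ (n + 1)).1 s ⊆
      (Φ n).1 s ∩ Metric.closedBall (f n (Φ n) s) ((1 / 2 : ℝ) ^ n) :=
    fun n s => hnext n (Φ n) s
  have hint : ∀ s, (⋂ n, (Φ n).1 s).Nonempty := fun s =>
    IsCompact.nonempty_iInter_of_sequence_nonempty_isCompact_isClosed (fun n => (Φ n).1 s)
      (fun n => (hΦ n s).trans Set.inter_subset_left) (fun n => (Φ n).2.2.1 s)
      ((Φ 0).2.1 s) fun n => ((Φ n).2.1 s).isClosed
  choose σ hσ using hint
  refine ⟨σ, ?_, fun s => Set.mem_iInter.1 (hσ s) 0⟩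
  let : MeasurableSpace A := borel A
  have : BorelSpace A := ⟨rfl⟩
  -- The point `σ s` is picked by choice from the nested intersection; it is measurable because it
  -- is the limit of the measurable centres, being within `(1 / 2) ^ n` of the `n`-th.
  refine measurable_of_tendsto_metrizable (fun n => hf n (Φ n)) (tendsto_pi_nhds.2 fun s => ?_)
  refine tendsto_iff_dist_tendsto_zero.2 (squeeze_zero (fun _ => dist_nonneg) (fun n => ?_)
    (tendsto_pow_atTop_nhds_zero_of_lt_one (by norm_num) (by norm_num : (1 / 2 : ℝ) < 1)))
  rw [dist_comm]
  exact (hΦ n s (Set.mem_iInter.1 (hσ s) (n + 1))).2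

/-- A continuous function on the graph of a continuous compact-valued correspondence has a
Borel measurable selection of maximizers. -/
theorem exists_measurable_argmax {S : Type*} [TopologicalSpace S]
    [TopologicalSpace.SeparableSpace A] {Γ : S → Set A}
    (hu : UpperHemicontinuous Γ) (hl : LowerHemicontinuous Γ) (hc : ∀ s, IsCompact (Γ s))
    (hne : ∀ s, (Γ s).Nonempty) {G : S × A → ℝ} (hG : ContinuousOn G {p | p.2 ∈ Γ p.1}) :
    ∃ σ : S → A, @Measurable _ _ (borel S) (borel A) σ ∧
      ∀ s, σ s ∈ Γ s ∧ IsMaxOn (fun a => G (s, a)) (Γ s) (σ s) := by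
  let : MeasurableSpace S := borel S
  have : BorelSpace S := ⟨rfl⟩
  let m : S → ℝ := fun s => sSup ((fun a => G (s, a)) '' Γ s)
  have hm : Continuous m := continuous_sSup_image_of_hemicontinuous hu hl hc hne hG
  have key := exists_isGreatest_image_of_continuousOn_graph hc hne hG
  have hG' : ContinuousOn (fun p : S × A => G p - m p.1) {p | p.2 ∈ Γ p.1} :=
    hG.sub (hm.comp continuous_fst).continuousOn
  -- Maximizers are the zeros of `G - m`, continuous on the graph by Berge. So the states having a
  -- maximizer in a closed set form a closed, hence Borel, set.
  have hclosed : ∀ F, IsClosed F →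
      IsClosed {s | ∃ a ∈ Γ s, a ∈ F ∧ G (s, a) - m s ∈ ({0} : Set ℝ)} :=
    fun F hF => hu.isClosed_setOf_exists_mem_preimage hc hG' hF isClosed_singleton
  have hΨc : ∀ s, IsCompact {a | a ∈ Γ s ∧ G (s, a) = m s} := fun s => by
    have hcont : ContinuousOn (fun a => G (s, a)) (Γ s) :=
      hG.comp (by fun_prop) fun a ha => ha
    exact (hc s).of_isClosed_subset
      (hcont.preimage_isClosed_of_isClosed (hc s).isClosed (isClosed_singleton (x := m s)))
      fun a ha => ha.1
  have hΨne : ∀ s, {a | a ∈ Γ s ∧ G (s, a) = m s}.Nonempty := fun s => by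
    obtain ⟨a, ha, -, hgr⟩ := key s
    exact ⟨a, ha, hgr.csSup_eq.symm⟩
  have hΨm : ∀ F, IsClosed F →
      MeasurableSet {s | ({a | a ∈ Γ s ∧ G (s, a) = m s} ∩ F).Nonempty} := fun F hF => by
    convert (hclosed F hF).measurableSet using 1
    ext s
    simp only [Set.Nonempty, Set.mem_inter_iff, Set.mem_ofPred, Set.mem_singleton_iff, sub_eq_zero]
    exact exists_congr fun a => by tauto
  obtain ⟨σ, hσ, hmem⟩ := exists_measurable_selection hΨc hΨne hΨm
  refine ⟨σ, hσ, fun s => ⟨(hmem s).1, fun b hb => ?_⟩⟩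
  obtain ⟨a, ha, -, hgr⟩ := key s
  have h1 : G (s, σ s) = m s := (hmem s).2
  have h2 : m s = G (s, a) := hgr.csSup_eq
  change G (s, b) ≤ G (s, σ s)
  rw [h1, h2]
  exact hgr.2 ⟨b, hb, rfl⟩

end MeasurableSelection

/-! ### Completeness of the space of bounded measurable functions. -/

section BoundedMeasurable

variable {Y : Type*} [TopologicalSpace Y]

theorem isClosed_bmSubmodule (Y : Type*) [TopologicalSpace Y] :
    IsClosed (bmSubmodule Y : Set (lp (fun _ : Y => ℝ) ∞)) := by
  let : MeasurableSpace Y := borel Y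
  refine IsSeqClosed.isClosed fun f g hf hg => ?_
  refine measurable_of_tendsto_metrizable (f := fun n => (f n : Y → ℝ)) (fun n => hf n)
    (tendsto_pi_nhds.2 fun y => ?_)
  refine tendsto_iff_dist_tendsto_zero.2 (squeeze_zero (fun _ => dist_nonneg) (fun n => ?_)
    (tendsto_iff_dist_tendsto_zero.1 hg))
  rw [Real.dist_eq, dist_eq_norm]
  exact lp.norm_apply_le_norm (by simp) (f n - g) y

instance bm.instCompleteSpace (Y : Type*) [TopologicalSpace Y] : CompleteSpace (bm Y) :=
  (isClosed_bmSubmodule Y).completeSpace_coe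

theorem bm.dist_le {f g : bm Y} {C : ℝ} (hC : 0 ≤ C) (h : ∀ y, |f y - g y| ≤ C) :
    dist f g ≤ C := by
  rw [dist_eq_norm]
  exact bm.norm_le _ hC h

theorem bm.abs_sub_le_dist (f g : bm Y) (y : Y) : |f y - g y| ≤ dist f g := by
  rw [dist_eq_norm]
  exact bm.abs_le_norm (f - g) y

/-- A constant function, as an element of `bm Y`. -/
noncomputable def bm.const (Y : Type*) [TopologicalSpace Y] (c : ℝ) : bm Y :=
  bm.mk (fun _ => c) (@measurable_const _ _ _ (borel Y) c) ⟨|c|, fun _ => le_rfl⟩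

theorem bm.norm_const_le (Y : Type*) [TopologicalSpace Y] {c : ℝ} (hc : 0 ≤ c) :
    ‖bm.const Y c‖ ≤ c :=
  bm.norm_le _ hc fun _ => (abs_of_nonneg hc).le

/-- A bounded continuous function, as a bounded measurable function. -/
noncomputable def bm.ofContinuous (v : Y →ᵇ ℝ) : bm Y :=
  bm.mk v (by
      let : MeasurableSpace Y := borel Y
      have : BorelSpace Y := ⟨rfl⟩
      exact v.continuous.measurable)
    ⟨‖v‖, fun y => v.norm_coe_le_norm y⟩

end BoundedMeasurable

/-! ### Spectral radius and eventual contractions. -/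

section EventualContraction

/-- Root test: for `q` strictly between `max r 0` and 1, eventually `‖L ^ n‖ ≤ q ^ n`. -/
theorem IsSpectralRadius.tendsto_norm_pow {E : Type*} [NormedAddCommGroup E] [NormedSpace ℝ E]
    {L : E →L[ℝ] E} {r : ℝ} (h : IsSpectralRadius L r) (hr : r < 1) :
    Tendsto (fun n : ℕ => ‖L ^ n‖) atTop (𝓝 0) := by
  obtain ⟨q, hrq, hq1⟩ := exists_between (max_lt hr one_pos)
  have hq0 : 0 < q := (le_max_right _ _).trans_lt hrq
  refine squeeze_zero' (Eventually.of_forall fun _ => norm_nonneg _) ?_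
    (tendsto_pow_atTop_nhds_zero_of_lt_one hq0.le hq1)
  filter_upwards [h.eventually_lt_const ((le_max_left _ _).trans_lt hrq), eventually_ge_atTop 1]
    with n hn hn1
  have hn0 : n ≠ 0 := by omega
  calc ‖L ^ n‖ = (‖L ^ n‖ ^ (1 / (n : ℝ))) ^ n := by
        rw [one_div, Real.rpow_inv_natCast_pow (norm_nonneg _) hn0]
    _ ≤ q ^ n := pow_le_pow_left₀ (by positivity) hn.le n

/-- `M` commutes with its contracting iterate, hence fixes that iterate's unique fixed point;
conversely every fixed point of `M` is fixed by the iterate. -/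
theorem EventuallyContracting.existsUnique_fixedPoint {Y : Type*} [MetricSpace Y]
    [CompleteSpace Y] [Nonempty Y] {M : Y → Y} (h : EventuallyContracting M) :
    ∃! y, M y = y := by
  obtain ⟨n, -, c, hc⟩ := h
  refine ⟨_, hc.isFixedPt_fixedPoint_iterate, fun y hy => ?_⟩
  exact hc.fixedPoint_unique (Function.IsFixedPt.iterate hy n)

theorem eventuallyContracting_of_dist_iterate_le {Y : Type*} [MetricSpace Y] {M : Y → Y}
    {a : ℕ → ℝ} (ha : Tendsto a atTop (𝓝 0)) (ha0 : ∀ n, 0 ≤ a n)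
    (h : ∀ n v w, dist (M^[n] v) (M^[n] w) ≤ a n * dist v w) : EventuallyContracting M := by
  obtain ⟨n, hn, hn1⟩ := ((ha.eventually_lt_const one_pos).and (eventually_ge_atTop 1)).exists
  exact ⟨n, hn1, ⟨a n, ha0 n⟩, NNReal.coe_lt_coe.1 hn, LipschitzWith.of_dist_le_mul (h n)⟩

end EventualContraction

namespace DynamicProgram

/-! ### Domination by a linear operator on the exogenous state. -/

section Dominated

variable {X Z : Type*} [MetricSpace Z]

/-- `M` maps `V` to itself, and pointwise distance bounds in terms of the exogenous state are
propagated by `L`. -/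
structure Dominated (M : (X × Z → ℝ) → (X × Z → ℝ)) (V : Set (X × Z → ℝ))
    (L : bm Z →L[ℝ] bm Z) : Prop where
  mapsTo : Set.MapsTo M V V
  abs_sub_le : ∀ v ∈ V, ∀ w ∈ V, ∀ h : bm Z, (∀ x z, |v (x, z) - w (x, z)| ≤ h z) →
    ∀ x z, |M v (x, z) - M w (x, z)| ≤ L h z

namespace Dominated

variable {M : (X × Z → ℝ) → (X × Z → ℝ)} {V : Set (X × Z → ℝ)} {L : bm Z →L[ℝ] bm Z}

theorem abs_iterate_sub_le (hM : Dominated M V L) (n : ℕ) :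
    ∀ v ∈ V, ∀ w ∈ V, ∀ h : bm Z, (∀ x z, |v (x, z) - w (x, z)| ≤ h z) →
      ∀ x z, |M^[n] v (x, z) - M^[n] w (x, z)| ≤ (L ^ n) h z := by
  induction n with
  | zero => exact fun v _ w _ h hvw => hvw
  | succ n ih =>
    intro v hv w hw h hvw x z
    exact ih _ (hM.mapsTo hv) _ (hM.mapsTo hw) (L h) (hM.abs_sub_le v hv w hw h hvw) x z

/-- The constant `c` is a majorant lying in `bm Z`, so pointwise domination becomes an operator-norm
estimate. -/
theorem abs_iterate_sub_le_norm_mul (hM : Dominated M V L) (n : ℕ) {v w : X × Z → ℝ}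
    (hv : v ∈ V) (hw : w ∈ V) {c : ℝ} (hc : 0 ≤ c) (hvw : ∀ s, |v s - w s| ≤ c) (s : X × Z) :
    |M^[n] v s - M^[n] w s| ≤ ‖L ^ n‖ * c :=
  calc |M^[n] v s - M^[n] w s| ≤ (L ^ n) (bm.const Z c) s.2 :=
        hM.abs_iterate_sub_le n v hv w hw (bm.const Z c) (fun x z => hvw (x, z)) s.1 s.2
    _ ≤ ‖(L ^ n) (bm.const Z c)‖ := (le_abs_self _).trans (bm.abs_le_norm _ _)
    _ ≤ ‖L ^ n‖ * ‖bm.const Z c‖ := (L ^ n).le_opNorm _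
    _ ≤ ‖L ^ n‖ * c := by gcongr; exact bm.norm_const_le Z hc

/-- A dominated operator whose dominating operator has powers tending to zero is eventually
contracting on any space `E` of functions with the supremum distance. -/
theorem eventuallyContracting (hM : Dominated M V L)
    (hL : Tendsto (fun n : ℕ => ‖L ^ n‖) atTop (𝓝 0)) {E : Type*} [MetricSpace E]
    (coe : E → X × Z → ℝ) (hV : ∀ v, coe v ∈ V)
    (hle : ∀ (v w : E) (C : ℝ), 0 ≤ C → (∀ s, |coe v s - coe w s| ≤ C) → dist v w ≤ C)
    (hge : ∀ (v w : E) s, |coe v s - coe w s| ≤ dist v w)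
    {M' : E → E} (hM' : ∀ v, coe (M' v) = M (coe v)) : EventuallyContracting M' := by
  refine eventuallyContracting_of_dist_iterate_le hL (fun _ => norm_nonneg _) fun n v w => ?_
  have hsemi : ∀ v, coe (M'^[n] v) = M^[n] (coe v) :=
    Function.Semiconj.iterate_right (f := coe) hM' n
  refine hle _ _ _ (by positivity) fun s => ?_
  rw [hsemi, hsemi]
  exact hM.abs_iterate_sub_le_norm_mul n (hV v) (hV w) dist_nonneg (hge v w) s

end Dominated

end Dominated

/-! ### Policy and Bellman operators under regularity and contractivity. -/

variable {X Z A : Type*} [MetricSpace X] [MetricSpace Z] [MetricSpace A]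
  {D : DynamicProgram X Z A}

/-- If the aggregator is bounded by the discounted expected distance of continuation values, then
pointwise bounds on continuation values that depend only on the exogenous state are propagated by
the discount operator. -/
theorem abs_H_sub_le [IsMarkovKernel D.Q] {β : bm Z} (hβ : ∀ z, 0 ≤ β z) {v w : X × Z → ℝ}
    {x : X} {z : Z} {a : A}
    (hH : ENNReal.ofReal |D.H x z a v - D.H x z a w| ≤ ENNReal.ofReal (β z) *
      upperIntegral (D.Q z) (fun z' => ⨆ x' : X, ENNReal.ofReal |v (x', z') - w (x', z')|))
    {h : bm Z} (hvw : ∀ x z, |v (x, z) - w (x, z)| ≤ h z) :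
    |D.H x z a v - D.H x z a w| ≤ discountOp D.Q β h z := by
  have h0 : ∀ z', 0 ≤ h z' := fun z' => (abs_nonneg _).trans (hvw x z')
  have hmeas : @Measurable Z ℝ≥0∞ (borel Z) _ fun z' => ENNReal.ofReal (h z') := by
    let : MeasurableSpace Z := borel Z
    exact (bm.measurable h).ennreal_ofReal
  have hub : upperIntegral (D.Q z) (fun z' => ⨆ x' : X, ENNReal.ofReal |v (x', z') - w (x', z')|)
      ≤ ENNReal.ofReal (∫ z', h z' ∂(D.Q z)) := by
    rw [ofReal_integral_eq_lintegral_ofReal (bm.integrable h _) (Eventually.of_forall h0)]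
    exact iInf_le_of_le _ (iInf_le_of_le hmeas (iInf_le_of_le
      (fun z' => iSup_le fun x' => ENNReal.ofReal_le_ofReal (hvw x' z')) le_rfl))
  have hint : 0 ≤ ∫ z', h z' ∂(D.Q z) := integral_nonneg h0
  rw [discountOp_apply, ← ENNReal.ofReal_le_ofReal_iff (mul_nonneg (hβ z) hint),
    ENNReal.ofReal_mul (hβ z)]
  exact hH.trans (by gcongr)

/-- A common bound for the aggregator at a bounded measurable continuation value. -/
theorem IsRegular.exists_abs_H_le (hreg : D.IsRegular) (hcon : D.IsLongRunContractive)
    (v : bm (X × Z)) : ∃ C, ∀ s, ∀ a ∈ D.Γ s, |D.H s.1 s.2 a v| ≤ C := by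
  have := D.markov
  obtain ⟨β, hβ, hH, -⟩ := hcon
  obtain ⟨w, C, hC⟩ := hreg.H_bounded
  let w' := bm.ofContinuous w
  -- Boundedness is assumed at one continuous `w` only; contractivity carries it to `v` at the cost
  -- of the discounted constant `dist v w'`.
  refine ⟨C + ‖discountOp D.Q β (bm.const Z (dist v w'))‖, fun s a ha => ?_⟩
  have h1 : |D.H s.1 s.2 a w'| ≤ C := hC ⟨(s, a), ha⟩
  have h2 := abs_H_sub_le hβ (hH v (hreg.V_eq ▸ ⟨v, rfl⟩) w' (hreg.V_eq ▸ ⟨w', rfl⟩) s.1 s.2 a ha)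
    (h := bm.const Z (dist v w')) fun x z => bm.abs_sub_le_dist v w' (x, z)
  have h3 := (le_abs_self _).trans (bm.abs_le_norm (discountOp D.Q β (bm.const Z (dist v w'))) s.2)
  have h4 := abs_sub_abs_le_abs_sub (D.H s.1 s.2 a v) (D.H s.1 s.2 a w')
  linarith

theorem IsRegular.continuousOn_H (hreg : D.IsRegular) (v : (X × Z) →ᵇ ℝ) :
    ContinuousOn (fun p : (X × Z) × A => D.H p.1.1 p.1.2 p.2 v) {p | p.2 ∈ D.Γ p.1} :=
  continuousOn_iff_continuous_domRestrict.2 (hreg.H_continuous v)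

theorem IsRegular.measurable_policyOp [TopologicalSpace.SeparableSpace A] (hreg : D.IsRegular)
    {σ : X × Z → A} (hσ : D.IsPolicy σ) (v : bm (X × Z)) :
    Measurable[borel (X × Z)] (D.policyOp σ v) := by
  let : MeasurableSpace (X × Z) := borel (X × Z)
  have : BorelSpace (X × Z) := ⟨rfl⟩
  let : MeasurableSpace A := borel A
  have : BorelSpace A := ⟨rfl⟩
  -- Second countability of one factor makes the Borel σ-algebra of `(X × Z) × A` the product one,
  -- so `s ↦ (s, σ s)` is Borel into the graph.
  have : SecondCountableTopology A := UniformSpace.secondCountable_of_separable A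
  have hsel : Measurable fun s => (⟨(s, σ s), hσ.2 s⟩ : D.graph) :=
    (measurable_id.prodMk hσ.1).subtype_mk
  have hH : Measurable (D.HGraph v) := by
    have := hreg.H_measurable v
    rwa [← BorelSpace.measurable_eq (α := D.graph)] at this
  exact hH.comp hsel

theorem IsRegular.exists_policyOp [TopologicalSpace.SeparableSpace A] (hreg : D.IsRegular)
    (hcon : D.IsLongRunContractive) {σ : X × Z → A} (hσ : D.IsPolicy σ) :
    ∃ M : bm (X × Z) → bm (X × Z), ∀ v, ⇑(M v) = D.policyOp σ v := by
  refine ⟨fun v => bm.mk (D.policyOp σ v) (hreg.measurable_policyOp hσ v) ?_, fun v => rfl⟩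
  obtain ⟨C, hC⟩ := hreg.exists_abs_H_le hcon v
  exact ⟨C, fun s => hC s _ (hσ.2 s)⟩

theorem IsRegular.isLUB_bellmanOp (hreg : D.IsRegular) (hcon : D.IsLongRunContractive)
    (v : bm (X × Z)) (s : X × Z) : IsLUB (D.actionValues v s) (D.bellmanOp v s) := by
  obtain ⟨C, hC⟩ := hreg.exists_abs_H_le hcon v
  refine isLUB_csSup ((hreg.nonempty s).image _) ⟨C, ?_⟩
  rintro _ ⟨a, ha, rfl⟩
  exact (le_abs_self _).trans (hC s a ha)

theorem IsRegular.exists_bellmanOp (hreg : D.IsRegular) (hcon : D.IsLongRunContractive) :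
    ∃ M : ((X × Z) →ᵇ ℝ) → ((X × Z) →ᵇ ℝ), ∀ v, ⇑(M v) = D.bellmanOp v := by
  have hb : ∀ v : (X × Z) →ᵇ ℝ, ∃ C, ∀ s, ‖D.bellmanOp v s‖ ≤ C := by
    intro v
    obtain ⟨C, hC⟩ := hreg.exists_abs_H_le hcon (bm.ofContinuous v)
    refine ⟨C, fun s => ?_⟩
    have hlub := hreg.isLUB_bellmanOp hcon (bm.ofContinuous v) s
    obtain ⟨a, ha⟩ := hreg.nonempty s
    refine abs_le.2 ⟨?_, hlub.2 ?_⟩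
    · exact (neg_le_of_abs_le (hC s a ha)).trans (hlub.1 ⟨a, ha, rfl⟩)
    · rintro _ ⟨b, hb, rfl⟩
      exact (le_abs_self _).trans (hC s b hb)
  choose C hC using hb
  exact ⟨fun v => BoundedContinuousFunction.ofNormedAddCommGroup (D.bellmanOp v)
    (continuous_sSup_image_of_hemicontinuous hreg.upper hreg.lower hreg.compact hreg.nonempty
      (hreg.continuousOn_H v)) (C v) (hC v), fun v => rfl⟩

/-- Long-run contractivity yields an operator on functions of the exogenous state with powers
tending to zero that dominates all policy operators and the Bellman operator. -/
theorem IsRegular.exists_dominating [TopologicalSpace.SeparableSpace A] (hreg : D.IsRegular)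
    (hcon : D.IsLongRunContractive) :
    ∃ L : bm Z →L[ℝ] bm Z, Tendsto (fun n : ℕ => ‖L ^ n‖) atTop (𝓝 0) ∧
      (∀ σ, D.IsPolicy σ → Dominated (D.policyOp σ) D.V L) ∧
      Dominated D.bellmanOp {v | ∃ u : (X × Z) →ᵇ ℝ, ⇑u = v} L := by
  have := D.markov
  have hcon' := hcon
  obtain ⟨β, hβ, hH, r, hr, hrad⟩ := hcon'
  refine ⟨discountOp D.Q β, hrad.tendsto_norm_pow hr, fun σ hσ => ⟨?_, ?_⟩, ?_, ?_⟩
  · obtain ⟨M, hM⟩ := hreg.exists_policyOp hcon hσ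
    rw [hreg.V_eq]
    rintro _ ⟨v, rfl⟩
    exact ⟨M v, hM v⟩
  · intro v hv w hw h hvw x z
    exact abs_H_sub_le hβ (hH v hv w hw x z _ (hσ.2 (x, z))) hvw
  · obtain ⟨M, hM⟩ := hreg.exists_bellmanOp hcon
    rintro _ ⟨v, rfl⟩
    exact ⟨M v, hM v⟩
  -- Only a one-sided estimate is needed: bound each action value of `v` by that of `w` plus the
  -- discounted `h`, pass to the supremum, then exchange `v` and `w`.
  · have key : ∀ (v w : (X × Z) →ᵇ ℝ) (h : bm Z), (∀ x z, |v (x, z) - w (x, z)| ≤ h z) →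
        ∀ x z, D.bellmanOp v (x, z) - D.bellmanOp w (x, z) ≤ discountOp D.Q β h z := by
      intro v w h hvw x z
      rw [sub_le_iff_le_add]
      refine (hreg.isLUB_bellmanOp hcon (bm.ofContinuous v) (x, z)).2 ?_
      rintro _ ⟨a, ha, rfl⟩
      have h1 := abs_H_sub_le hβ (hH v (hreg.V_eq ▸ ⟨bm.ofContinuous v, rfl⟩) w
        (hreg.V_eq ▸ ⟨bm.ofContinuous w, rfl⟩) x z a ha) hvw
      have h2 : D.H x z a w ≤ D.bellmanOp w (x, z) :=
        (hreg.isLUB_bellmanOp hcon (bm.ofContinuous w) (x, z)).1 ⟨a, ha, rfl⟩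
      have h3 := (le_abs_self _).trans h1
      change D.H x z a v ≤ _
      linarith
    rintro _ ⟨v, rfl⟩ _ ⟨w, rfl⟩ h hvw x z
    refine abs_sub_le_iff.2 ⟨key v w h hvw x z, key w v h (fun x z => ?_) x z⟩
    rw [abs_sub_comm]
    exact hvw x z

/-- A fixed point of a policy operator is the value of the policy. -/
theorem Dominated.isPolicyValue {σ : X × Z → A} {L : bm Z →L[ℝ] bm Z}
    (hσ : Dominated (D.policyOp σ) D.V L) (hreg : D.IsRegular)
    (hL : Tendsto (fun n : ℕ => ‖L ^ n‖) atTop (𝓝 0)) {u : bm (X × Z)}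
    (hu : D.policyOp σ u = u) : D.IsPolicyValue σ u := by
  intro v₀ hv₀ s
  have hv₀' := hv₀
  rw [hreg.V_eq] at hv₀'
  obtain ⟨v, rfl⟩ := hv₀'
  have hlim := hL.mul_const (dist v u)
  rw [zero_mul] at hlim
  refine tendsto_iff_dist_tendsto_zero.2 (squeeze_zero (fun _ => dist_nonneg) (fun n => ?_) hlim)
  have := hσ.abs_iterate_sub_le_norm_mul n hv₀ (hreg.V_eq ▸ ⟨u, rfl⟩) dist_nonneg
    (bm.abs_sub_le_dist v u) s
  rwa [Function.iterate_fixed hu] at this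

theorem IsPolicyValue.unique {σ : X × Z → A} {u w : X × Z → ℝ} (hu : D.IsPolicyValue σ u)
    (hw : D.IsPolicyValue σ w) : u = w := by
  obtain ⟨v, hv⟩ := D.V_nonempty
  exact funext fun s => tendsto_nhds_unique (hu v hv s) (hw v hv s)

theorem IsValueFunction.unique {u w : X × Z → ℝ} (hu : D.IsValueFunction u)
    (hw : D.IsValueFunction w) : u = w :=
  funext fun s => (hu.2 s).unique (hw.2 s)

/-- The value of a policy lies below any candidate that its policy operator decreases. -/
theorem IsMonotone.policyValue_le (hmon : D.IsMonotone) {σ : X × Z → A} (hσ : D.IsPolicy σ)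
    (hmaps : Set.MapsTo (D.policyOp σ) D.V D.V) {u w : X × Z → ℝ} (hu : D.IsPolicyValue σ u)
    (hw : w ∈ D.V) (hle : D.policyOp σ w ≤ w) : u ≤ w := by
  have hmem : ∀ n, (D.policyOp σ)^[n] w ∈ D.V := fun n => hmaps.iterate n hw
  have hiter : ∀ n, (D.policyOp σ)^[n] w ≤ w := by
    intro n
    induction n with
    | zero => exact le_rfl
    | succ n ih =>
      rw [Function.iterate_succ_apply']
      exact le_trans (fun s => hmon _ (hmem n) _ hw ih s.1 s.2 _ (hσ.2 s)) hle
  exact fun s => le_of_tendsto' (hu w hw s) fun n => hiter n s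

end DynamicProgram

/-! ### The optimality theorem. -/

theorem theoremt {X Z A : Type*} [MetricSpace X] [MetricSpace Z] [MetricSpace A]
    [TopologicalSpace.SeparableSpace A] (D : DynamicProgram X Z A) (hreg : D.IsRegular)
    (hmon : D.IsMonotone) (hcon : D.IsLongRunContractive) :
    -- the supremum that defines `T` is finite on all candidate value functions
    (∀ v ∈ D.V, ∀ s, IsLUB (D.actionValues v s) (D.bellmanOp v s)) ∧
    -- (a) `T_σ` and `T` are eventually contracting self-maps of `bm S` and `bc S`
    (∀ σ, D.IsPolicy σ → ∃ M : bm (X × Z) → bm (X × Z),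
      (∀ v, ⇑(M v) = D.policyOp σ v) ∧ EventuallyContracting M) ∧
    (∃ M : ((X × Z) →ᵇ ℝ) → ((X × Z) →ᵇ ℝ),
      (∀ v, ⇑(M v) = D.bellmanOp v) ∧ EventuallyContracting M) ∧
    -- (b) lifetime values are well defined
    (∀ σ, D.IsPolicy σ → ∃ u : bm (X × Z), D.IsPolicyValue σ u) ∧
    -- (c), (d), (e)
    ∃ vstar : (X × Z) →ᵇ ℝ,
      D.IsValueFunction vstar ∧
      (∀ v : (X × Z) →ᵇ ℝ, D.bellmanOp v = v ↔ v = vstar) ∧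
      (∃ σ, D.IsOptimal σ) ∧
      ∀ σ, D.IsPolicy σ →
        (D.IsOptimal σ ↔ ∀ x z, σ (x, z) ∈ D.Γ (x, z) ∧
          IsMaxOn (fun a => D.H x z a vstar) (D.Γ (x, z)) (σ (x, z))) := by
  obtain ⟨L, hL, hdomσ, hdomT⟩ := hreg.exists_dominating hcon
  have hbmV : ∀ u : bm (X × Z), ⇑u ∈ D.V := fun u => hreg.V_eq ▸ ⟨u, rfl⟩
  have hbcV : ∀ u : (X × Z) →ᵇ ℝ, ⇑u ∈ D.V := fun u => hbmV (bm.ofContinuous u)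
  have hpol : ∀ σ, D.IsPolicy σ → ∃ M : bm (X × Z) → bm (X × Z),
      (∀ v, ⇑(M v) = D.policyOp σ v) ∧ EventuallyContracting M := fun σ hσ => by
    obtain ⟨M, hM⟩ := hreg.exists_policyOp hcon hσ
    exact ⟨M, hM, (hdomσ σ hσ).eventuallyContracting hL (fun u : bm (X × Z) => ⇑u) hbmV
      (fun _ _ _ => bm.dist_le) bm.abs_sub_le_dist hM⟩
  have hbell : ∃ M : ((X × Z) →ᵇ ℝ) → ((X × Z) →ᵇ ℝ),
      (∀ v, ⇑(M v) = D.bellmanOp v) ∧ EventuallyContracting M := by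
    obtain ⟨M, hM⟩ := hreg.exists_bellmanOp hcon
    exact ⟨M, hM, hdomT.eventuallyContracting hL (fun u : (X × Z) →ᵇ ℝ => ⇑u) (fun u => ⟨u, rfl⟩)
      (fun _ _ _ hC h => (BoundedContinuousFunction.dist_le hC).2 h)
      (fun v w s => (Real.dist_eq _ _).symm.trans_le
        (BoundedContinuousFunction.dist_coe_le_dist (f := v) (g := w) s)) hM⟩
  have hval : ∀ σ, D.IsPolicy σ → ∃ u : bm (X × Z),
      D.policyOp σ u = u ∧ D.IsPolicyValue σ u := fun σ hσ => by
    obtain ⟨M, hM, hMc⟩ := hpol σ hσ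
    obtain ⟨u, hu, -⟩ := hMc.existsUnique_fixedPoint
    have hfix : D.policyOp σ u = u := by rw [← hM, hu]
    exact ⟨u, hfix, (hdomσ σ hσ).isPolicyValue hreg hL hfix⟩
  refine ⟨fun v hv s => ?_, hpol, hbell, fun σ hσ => (hval σ hσ).imp fun u hu => hu.2, ?_⟩
  · rw [hreg.V_eq] at hv
    obtain ⟨u, rfl⟩ := hv
    exact hreg.isLUB_bellmanOp hcon u s
  obtain ⟨M, hM, hMc⟩ := hbell
  obtain ⟨vstar, hfix, huniq⟩ := hMc.existsUnique_fixedPoint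
  have hTv : D.bellmanOp vstar = vstar := by rw [← hM, hfix]
  have hH_le : ∀ s, ∀ a ∈ D.Γ s, D.H s.1 s.2 a vstar ≤ vstar s := fun s a ha =>
    ((hreg.isLUB_bellmanOp hcon (bm.ofContinuous vstar) s).1 ⟨a, ha, rfl⟩).trans_eq
      (congrFun hTv s)
  -- Since `vstar` is the supremum of its own action values, `T_σ` fixes it exactly when `σ` attains
  -- that supremum at every state.
  have hmax_iff : ∀ σ, D.IsPolicy σ → (D.policyOp σ vstar = vstar ↔
      ∀ s, IsMaxOn (fun a => D.H s.1 s.2 a vstar) (D.Γ s) (σ s)) := fun σ hσ => by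
    refine ⟨fun h s a ha => (hH_le s a ha).trans_eq (congrFun h s).symm, fun h => ?_⟩
    refine funext fun s => le_antisymm (hH_le s _ (hσ.2 s)) ?_
    refine (congrFun hTv s).symm.trans_le
      ((hreg.isLUB_bellmanOp hcon (bm.ofContinuous vstar) s).2 ?_)
    rintro _ ⟨a, ha, rfl⟩
    exact h s ha
  have hvalue_of_fixed : ∀ σ, D.IsPolicy σ → D.policyOp σ vstar = vstar →
      D.IsPolicyValue σ vstar := fun σ hσ h =>
    (hdomσ σ hσ).isPolicyValue hreg hL (u := bm.ofContinuous vstar) h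
  obtain ⟨τ, hτm, hτ⟩ := exists_measurable_argmax hreg.upper hreg.lower hreg.compact
    hreg.nonempty (hreg.continuousOn_H vstar)
  have hτp : D.IsPolicy τ := ⟨hτm, fun s => (hτ s).1⟩
  have hτv : D.IsPolicyValue τ vstar :=
    hvalue_of_fixed τ hτp ((hmax_iff τ hτp).2 fun s => (hτ s).2)
  have hvf : D.IsValueFunction vstar := by
    refine ⟨fun σ hσ => (hval σ hσ).elim fun u hu => ⟨u, hu.2⟩, fun s => ⟨?_, fun b hb => ?_⟩⟩
    -- Upper bound: `T_σ vstar ≤ vstar` and monotonicity. The selection `τ` then shows that the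
    -- bound is attained.
    · rintro _ ⟨σ, u, hσ, hu, rfl⟩
      exact hmon.policyValue_le hσ (hdomσ σ hσ).mapsTo hu (hbcV vstar)
        (fun t => hH_le t _ (hσ.2 t)) s
    · exact hb ⟨τ, vstar, hτp, hτv, rfl⟩
  refine ⟨vstar, hvf, fun v => ⟨fun h => huniq v (DFunLike.coe_injective ((hM v).trans h)), ?_⟩,
    ⟨τ, hτp, vstar, hvf, hτv⟩, fun σ hσ => ⟨?_, fun h => ?_⟩⟩
  · rintro rfl
    exact hTv
  · rintro ⟨-, w, hw, hσw⟩ x z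
    refine ⟨hσ.2 (x, z), (hmax_iff σ hσ).1 ?_ (x, z)⟩
    -- The value of `σ` is a fixed point `u` of `T_σ`; uniqueness of values and optimality identify
    -- `u` with `vstar`, so `T_σ` fixes `vstar`.
    obtain ⟨u, hu, huv⟩ := hval σ hσ
    have huw : (u : X × Z → ℝ) = vstar := (huv.unique hσw).trans (hw.unique hvf)
    rw [← huw, hu]
  · exact ⟨hσ, vstar, hvf, hvalue_of_fixed σ hσ ((hmax_iff σ hσ).2 fun s => (h s.1 s.2).2)⟩
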